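/- **Corollary 4.3 (robust PCA, centered case).** Let $X, X_1,\dots,X_n\in\mathbb R^D$ be identically distributed random vectors with $X_1,\dots,X_n$ independent, $\mathbb E X=0$, $\mathbb E\|X\|^4<\infty$ ($\|\cdot\|$ the Euclidean norm), and covariance matrix $\Sigma=\mathbb E[XX^T]$. For a symmetric $D\times D$ matrix $A$ let $\lambda_1(A)\ge\dots\ge\lambda_D(A)$ be its eigenvalues, counted with multiplicity, and set $\lambda_{D+1}(A):=0$; let $\|A\|_{\rm F}=\sqrt{\operatorname{tr}(A^TA)}$. Let $0<\delta<1$, $\psi(\alpha;p)=(1-\alpha)\log\frac{1-\alpha}{1-p}+\alpha\log\frac{\alpha}{p}$, and $$k=\Big\lfloor\frac{\log(1/\delta)}{\psi(7/18;\,0.1)}\Big\rfloor+1 ,$$ and assume $k\le n$. Let $G_1,\dots,G_k\subset\{1,\dots,n\}$ be disjoint groups of size $\lfloor n/k\rfloor$ each, put $$\hat\Sigma_j=\frac1{|G_j|}\sum_{i\in G_j}X_iX_i^T,\quad j=1,\dots,k,$$ and let $\hat\Sigma$ be a geometric median of $\hat\Sigma_1,\dots,\hat\Sigma_k$ in the Frobenius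 norm, that is, any minimizer of $Y\mapsto\sum_{j=1}^k\|Y-\hat\Sigma_j\|_{\rm F}$ over $Y\in\mathbb R^{D\times D}$. Let $1\le m\le D$, $\Delta_m=\lambda_m(\Sigma)-\lambda_{m+1}(\Sigma)$, and let $\mathrm{Proj}_m$ and $\widehat{\mathrm{Proj}}_m$ be the orthogonal projectors of rank $m$ onto the span of orthonormal eigenvectors for the $m$ largest eigenvalues of $\Sigma$ and of $\hat\Sigma$, respectively (chosen arbitrarily in case of a tie). Put $V=\mathbb E\|X\|^4-\operatorname{tr}(\Sigma^2)$ and assume that $$\Delta_m>44\sqrt{\frac{V\log(1.4/\delta)}{n}} .$$ Then $$\Pr\Big(\big\|\widehat{\mathrm{Proj}}_m-\mathrm{Proj}_m\big\|_{\rm F}>\frac{22}{\Delta_m}\sqrt{\frac{V\log(1.4/\delta)}{n}}\Big)\le\delta ,$$ and if $V>0$, then also $$\Pr\Big(\big\|\widehat{\mathrm{Proj}}_m-\mathrm{Proj}_m\big\|_{\rm F}\ge\frac{22}{\Delta_m}\sqrt{\frac{V\log(1.4/\delta)}{n}}\Big)\le\delta .$$ (If $\hat\Sigma$ or $\widehat{\mathrm{Proj}}_m$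 is chosen non-measurably, $\Pr$ denotes outer probability.) -/

import Mathlib

open MeasureTheory ProbabilityTheory

noncomputable section

namespace RobustPCA

/-- `ψ(α; p) = (1 - α) log ((1 - α) / (1 - p)) + α log (α / p)`. -/
def psi (α p : ℝ) : ℝ :=
  (1 - α) * Real.log ((1 - α) / (1 - p)) + α * Real.log (α / p)

/-- The number of groups `k = ⌊log (1 / δ) / ψ(7/18; 0.1)⌋ + 1`. -/
def numGroups (δ : ℝ) : ℕ :=
  ⌊Real.log (1 / δ) / psi (7 / 18) (1 / 10)⌋₊ + 1

/-- The Frobenius norm `‖A‖_F = √(tr (Aᵀ A))`. -/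
def frobNorm {D : ℕ} (A : Matrix (Fin D) (Fin D) ℝ) : ℝ :=
  √(Matrix.trace (A.transpose * A))

/-- `S` is a geometric median, with respect to the Frobenius norm, of the matrices
`x 1, …, x k`: it minimizes `∑ j, ‖S - x j‖_F` over all `D × D` matrices. -/
def IsGeometricMedian {D k : ℕ} (x : Fin k → Matrix (Fin D) (Fin D) ℝ)
    (S : Matrix (Fin D) (Fin D) ℝ) : Prop :=
  ∀ Y : Matrix (Fin D) (Fin D) ℝ, ∑ j, frobNorm (S - x j) ≤ ∑ j, frobNorm (Y - x j)

/-- The covariance matrix `𝔼 (X - 𝔼 X) (X - 𝔼 X)ᵀ` of a random vector `X` in `ℝ^D`. -/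
def covMatrix {Ω : Type*} [MeasurableSpace Ω] (P : Measure Ω) {D : ℕ}
    (X : Ω → EuclideanSpace ℝ (Fin D)) : Matrix (Fin D) (Fin D) ℝ :=
  Matrix.of fun a b => cov[fun ω => X ω a, fun ω => X ω b; P]

/-- The (uncentered) sample covariance matrix `|G|⁻¹ ∑_{i ∈ G} X_i X_iᵀ` of the observations
with indices in the group `G`. -/
def sampleCov {D n : ℕ} (x : Fin n → EuclideanSpace ℝ (Fin D)) (G : Finset (Fin n)) :
    Matrix (Fin D) (Fin D) ℝ :=
  (G.card : ℝ)⁻¹ • ∑ i ∈ G, Matrix.vecMulVec (x i).ofLp (x i).ofLp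

/-- `eigenval A i` is the `i`-th largest eigenvalue `λ_i(A)`, `1 ≤ i ≤ D`, of a symmetric
`D × D` matrix `A`, counted with multiplicity (Mathlib's `eigenvalues₀` is the list of eigenvalues
in decreasing order, indexed from `0`). By convention it is `0` for an index out of range, in
particular `λ_{D+1}(A) = 0`. -/
def eigenval {D : ℕ} (A : Matrix (Fin D) (Fin D) ℝ) (i : ℕ) : ℝ :=
  if h : A.IsHermitian ∧ 1 ≤ i ∧ i ≤ D then
    h.1.eigenvalues₀ ⟨i - 1, by rw [Fintype.card_fin]; omega⟩
  else 0

/-- `Q` is the orthogonal projector onto the span of `m` orthonormal eigenvectors of the symmetric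
matrix `A` that belong to its `m` largest eigenvalues `λ_1(A) ≥ … ≥ λ_m(A)`. It is unique if
`λ_m(A) > λ_{m+1}(A)`; in case of a tie, every choice of the eigenvectors is allowed. -/
def IsTopProjector {D : ℕ} (A : Matrix (Fin D) (Fin D) ℝ) (m : ℕ)
    (Q : Matrix (Fin D) (Fin D) ℝ) : Prop :=
  ∃ u : Fin m → EuclideanSpace ℝ (Fin D), Orthonormal ℝ u ∧
    (∀ i : Fin m, A.mulVec (u i).ofLp = eigenval A (i + 1) • (u i).ofLp) ∧
    Q = ∑ i, Matrix.vecMulVec (u i).ofLp (u i).ofLp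

end RobustPCA

end

/-! This is a median-of-means argument in the Hilbert space of matrices with the Frobenius norm.
With N = ⌊n/k⌋, Chebyshev shows that each group's `sampleCov` misses Σ by more than ε = √(10V/N)
with probability at most 1/10 (`measureReal_sampleCov_le`). The groups are independent, so a
fraction 7/18 or more of them is bad with probability at most exp(-kψ) ≤ δ
(`measureReal_le_card_le_exp_psi`). If fewer are bad, the geometric median lies within 11ε/√72 of Σ,
since otherwise moving it towards Σ would decrease the sum of distances
(`card_lt_of_geometric_median`).

The choice of k gives ε ≤ √72 R with R = √(V log(1.4/δ)/n), so the median is within 11R of Σ. The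
deterministic bound `davis_kahan` costs a factor 2/Δ and needs a positive gap for Σ only; this
yields 22R/Δ. If V > 0, then ε < √72 R, which leaves room for the non-strict event. -/

noncomputable section

namespace RobustPCA

/-! ### Geometric medians in an inner product space. -/

section GeometricMedian

variable {E : Type*} [NormedAddCommGroup E] [InnerProductSpace ℝ E]

/-- The derivative at `0` of the norm along a line that does not start at the origin. -/
theorem hasDerivAt_norm_add_smul {b : E} (hb : b ≠ 0) (d : E) :
    HasDerivAt (fun t : ℝ => ‖b + t • d‖) (inner ℝ b d / ‖b‖) 0 := by
  have h1 : HasDerivAt (fun t : ℝ => b + t • d) d 0 := by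
    simpa using ((hasDerivAt_id (0 : ℝ)).smul_const d).const_add b
  have h2 := h1.norm_sq
  have h3 := h2.sqrt (by simpa using hb)
  have hn : ‖b‖ ≠ 0 := by simpa using hb
  convert! h3 using 1
  · funext t
    simp
  · simp
    field_simp

/-- If `b` is closer to `-d` than `c ‖d‖`, then `b` and `d` form an obtuse angle whose cosine is
below `-√(1 - c²)`. -/
theorem inner_lt_of_norm_add_le {b d : E} {r c s : ℝ} (hr : ‖b + d‖ ≤ r)
    (hcs : s ^ 2 + c ^ 2 = 1) (hd : r < c * ‖d‖) :
    inner ℝ b d < -(s * (‖b‖ * ‖d‖)) := by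
  have h0 : 0 ≤ r := (norm_nonneg _).trans hr
  have hexp : ‖b + d‖ ^ 2 = ‖b‖ ^ 2 + 2 * inner ℝ b d + ‖d‖ ^ 2 := norm_add_sq_real b d
  have h1 : ‖b + d‖ ^ 2 < (c * ‖d‖) ^ 2 :=
    pow_lt_pow_left₀ (hr.trans_lt hd) (norm_nonneg _) two_ne_zero
  -- AM-GM: expanding the norm gives 2⟨b, d⟩ < -(‖b‖² + s²‖d‖²), which is at most -2s‖b‖‖d‖.
  have h2 : 0 ≤ (‖b‖ - s * ‖d‖) ^ 2 := sq_nonneg _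
  have h3 : (c * ‖d‖) ^ 2 = ‖d‖ ^ 2 - (s * ‖d‖) ^ 2 := by linear_combination ‖d‖ ^ 2 * hcs
  linarith [sub_sq ‖b‖ (s * ‖d‖)]

/-- **Geometric median of contaminated points.** If the distance from a geometric median to `z`
exceeds `r / c`, then more than a fraction `α = s / (1 + s)` of the points are
farther than `r` from `z`. -/
theorem card_lt_of_geometric_median {ι : Type*} [Fintype ι] (x : ι → E) (y z : E)
    (hy : ∀ w, ∑ j, ‖y - x j‖ ≤ ∑ j, ‖w - x j‖) {r c s : ℝ}
    (hc : 0 < c) (hcs : s ^ 2 + c ^ 2 = 1) (hd : r < c * ‖y - z‖) [Nonempty ι] :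
    s * ((Finset.univ.filter fun j => ‖x j - z‖ ≤ r).card : ℝ)
      < ((Finset.univ.filter fun j => ¬ ‖x j - z‖ ≤ r).card : ℝ) := by
  classical
  set J := Finset.univ.filter fun j => ‖x j - z‖ ≤ r with hJ
  set K := Finset.univ.filter fun j => ¬ ‖x j - z‖ ≤ r with hK
  by_cases hJ0 : J.card = 0
  · have hcard : J.card + K.card = Fintype.card ι :=
      Finset.card_filter_add_card_filter_not _
    have : 0 < K.card := by have := Fintype.card_pos (α := ι); omega
    rw [hJ0]
    simpa using this
  by_contra! hcon
  by_cases hr : r < 0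
  · apply hJ0
    rw [Finset.card_eq_zero, Finset.filter_eq_empty_iff]
    intro j _
    have := norm_nonneg (x j - z)
    linarith
  push Not at hr
  set d := z - y with hdd
  have hdn : ‖y - z‖ = ‖d‖ := norm_sub_rev _ _
  rw [hdn] at hd
  have hd0 : 0 < ‖d‖ := by
    by_contra! h
    have := mul_nonpos_of_nonneg_of_nonpos hc.le h
    linarith
  have hc1 : c ≤ 1 := by nlinarith [sq_nonneg s]
  have hbd : ∀ j ∈ J, ‖(y - x j) + d‖ ≤ r := by
    intro j hj
    have : (y - x j) + d = -(x j - z) := by rw [hdd]; abel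
    rw [this, norm_neg]
    exact (Finset.mem_filter.mp hj).2
  have hne : ∀ j ∈ J, y - x j ≠ 0 := by
    intro j hj h
    have h1 := hbd j hj
    rw [h, zero_add] at h1
    nlinarith
  -- For t ≥ 0 this majorizes the objective at `y + t • d`, with equality at t = 0. Far points enter
  -- through the triangle inequality, because one of them may equal `y`, where the norm is not
  -- differentiable. As `y` is a minimizer, the derivative of `g` at 0 is nonnegative, whereas each
  -- near point contributes less than -s‖d‖ to it.
  let g : ℝ → ℝ := fun t => ∑ j ∈ J, ‖(y - x j) + t • d‖ + ∑ j ∈ K, (‖y - x j‖ + t * ‖d‖)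
  have hg : HasDerivAt g
      (∑ j ∈ J, inner ℝ (y - x j) d / ‖y - x j‖ + ∑ _j ∈ K, ‖d‖) 0 := by
    refine HasDerivAt.add ?_ ?_
    · exact HasDerivAt.fun_sum fun j hj => hasDerivAt_norm_add_smul (hne j hj) d
    · refine HasDerivAt.fun_sum fun j _ => ?_
      simpa using ((hasDerivAt_id (0 : ℝ)).mul_const ‖d‖).const_add ‖y - x j‖
  have hmin : ∀ t, 0 ≤ t → g 0 ≤ g t := by
    intro t ht
    have h1 := hy (y + t • d)
    have e : ∀ f : ι → ℝ, ∑ j, f j = ∑ j ∈ J, f j + ∑ j ∈ K, f j := fun f =>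
      (Finset.sum_filter_add_sum_filter_not _ _ _).symm
    rw [e, e] at h1
    have h2 : ∑ j ∈ K, ‖y + t • d - x j‖ ≤ ∑ j ∈ K, (‖y - x j‖ + t * ‖d‖) := by
      refine Finset.sum_le_sum fun j _ => ?_
      have : y + t • d - x j = (y - x j) + t • d := by abel
      rw [this]
      refine (norm_add_le _ _).trans ?_
      rw [norm_smul, Real.norm_of_nonneg ht]
    have h3 : ∑ j ∈ J, ‖y + t • d - x j‖ = ∑ j ∈ J, ‖(y - x j) + t • d‖ :=
      Finset.sum_congr rfl fun j _ => by congr 1; abel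
    simp only [g, zero_smul, add_zero, zero_mul]
    linarith
  have hnonneg : 0 ≤ ∑ j ∈ J, inner ℝ (y - x j) d / ‖y - x j‖ + ∑ _j ∈ K, ‖d‖ := by
    have hs := hasDerivWithinAt_iff_tendsto_slope.mp (hg.hasDerivWithinAt (s := Set.Ioi 0))
    rw [Set.sdiff_singleton_eq_self (by simp)] at hs
    refine ge_of_tendsto hs ?_
    filter_upwards [self_mem_nhdsWithin] with t ht
    rw [slope_def_field]
    have ht' : (0 : ℝ) < t := ht
    exact div_nonneg (by linarith [hmin t ht'.le]) (by linarith)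
  have hlt : ∑ j ∈ J, inner ℝ (y - x j) d / ‖y - x j‖ < ∑ _j ∈ J, -(s * ‖d‖) := by
    refine Finset.sum_lt_sum_of_nonempty (Finset.card_ne_zero.mp hJ0) fun j hj => ?_
    have hb : 0 < ‖y - x j‖ := norm_pos_iff.mpr (hne j hj)
    rw [div_lt_iff₀ hb]
    have := inner_lt_of_norm_add_le (hbd j hj) hcs hd
    linarith [mul_comm ‖y - x j‖ ‖d‖, mul_assoc s ‖d‖ ‖y - x j‖,
      congrArg (s * ·) (mul_comm ‖y - x j‖ ‖d‖)]
  simp only [Finset.sum_const, nsmul_eq_mul] at hlt hnonneg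
  nlinarith

end GeometricMedian

/-! ### Frobenius geometry and symmetry of the median. -/

section Frobenius

variable {D : ℕ}

/-- A square matrix as a vector of a Euclidean space. -/
def frobVec : Matrix (Fin D) (Fin D) ℝ →ₗ[ℝ] EuclideanSpace ℝ (Fin D × Fin D) where
  toFun A := WithLp.toLp 2 fun p => A p.1 p.2
  map_add' _ _ := rfl
  map_smul' _ _ := rfl

theorem frobVec_apply (A : Matrix (Fin D) (Fin D) ℝ) (p : Fin D × Fin D) :
    frobVec A p = A p.1 p.2 := rfl

theorem inner_frobVec (A B : Matrix (Fin D) (Fin D) ℝ) :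
    inner ℝ (frobVec A) (frobVec B) = ∑ a, ∑ b, A a b * B a b := by
  simp only [PiLp.inner_apply, frobVec_apply, Fintype.sum_prod_type]
  exact Finset.sum_congr rfl fun a _ => Finset.sum_congr rfl fun b _ => by simp [mul_comm]

theorem norm_frobVec_sq (A : Matrix (Fin D) (Fin D) ℝ) :
    ‖frobVec A‖ ^ 2 = ∑ a, ∑ b, A a b ^ 2 := by
  rw [← real_inner_self_eq_norm_sq, inner_frobVec]
  simp only [sq]

theorem frobNorm_eq_norm (A : Matrix (Fin D) (Fin D) ℝ) : frobNorm A = ‖frobVec A‖ := by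
  rw [frobNorm, Real.sqrt_eq_iff_eq_sq ?_ (norm_nonneg _), norm_frobVec_sq, Finset.sum_comm]
  · simp [Matrix.trace, Matrix.mul_apply, sq]
  · simp only [Matrix.trace, Matrix.mul_apply, Matrix.diag_apply, Matrix.transpose_apply]
    exact Finset.sum_nonneg fun _ _ => Finset.sum_nonneg fun _ _ => mul_self_nonneg _

theorem frobVec_injective : Function.Injective (frobVec (D := D)) := by
  intro A B h
  ext a b
  exact congrArg (fun v : EuclideanSpace ℝ (Fin D × Fin D) => v (a, b)) h

theorem norm_frobVec_transpose (A : Matrix (Fin D) (Fin D) ℝ) :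
    ‖frobVec A.transpose‖ = ‖frobVec A‖ := by
  rw [← sq_eq_sq₀ (norm_nonneg _) (norm_nonneg _), norm_frobVec_sq, norm_frobVec_sq,
    Finset.sum_comm]
  rfl

/-- Symmetrizing a matrix that is not symmetric decreases its Frobenius norm. -/
theorem norm_frobVec_symmetrize_lt {A : Matrix (Fin D) (Fin D) ℝ} (hA : A.transpose ≠ A) :
    ‖frobVec ((2 : ℝ)⁻¹ • (A + A.transpose))‖ < ‖frobVec A‖ := by
  have h := parallelogram_law_with_norm ℝ (frobVec A) (frobVec A.transpose)
  rw [norm_frobVec_transpose] at h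
  have h0 : 0 < ‖frobVec A - frobVec A.transpose‖ := by
    rw [norm_pos_iff, sub_ne_zero]
    exact fun h => hA (frobVec_injective h).symm
  rw [map_smul, norm_smul, map_add]
  refine lt_of_pow_lt_pow_left₀ 2 (norm_nonneg _) ?_
  norm_num
  nlinarith

/-- Geometric medians of symmetric matrices are symmetric. -/
theorem IsGeometricMedian.isHermitian {k : ℕ} (hk : 0 < k)
    {x : Fin k → Matrix (Fin D) (Fin D) ℝ} {S : Matrix (Fin D) (Fin D) ℝ}
    (hx : ∀ j, (x j).transpose = x j) (hS : IsGeometricMedian x S) : S.IsHermitian := by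
  by_contra hne
  have hne' : S.transpose ≠ S := fun h => hne (by simpa [Matrix.IsHermitian] using h)
  -- The symmetric part of `S` is a strictly better competitor: as `x j` is symmetric, each `S - x
  -- j` is nonsymmetric and symmetrizing shortens it.
  have h := hS ((2 : ℝ)⁻¹ • (S + S.transpose))
  refine absurd h (not_le.mpr (Finset.sum_lt_sum_of_nonempty ?_ fun j _ => ?_))
  · exact Finset.univ_nonempty_iff.mpr (Fin.pos_iff_nonempty.mp hk)
  · have e : (2 : ℝ)⁻¹ • (S + S.transpose) - x j =
        (2 : ℝ)⁻¹ • ((S - x j) + (S - x j).transpose) := by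
      rw [Matrix.transpose_sub, hx j]
      module
    rw [frobNorm_eq_norm, frobNorm_eq_norm, e]
    refine norm_frobVec_symmetrize_lt fun h' => hne' ?_
    rw [Matrix.transpose_sub, hx j] at h'
    exact sub_left_injective h'

end Frobenius

/-! ### Ky Fan and Davis–Kahan inequalities. -/

section SpectralProjector

variable {D : ℕ}

/-- The orthogonal projector onto the span of an orthonormal family. -/
def projectorOf {m : ℕ} (u : Fin m → EuclideanSpace ℝ (Fin D)) : Matrix (Fin D) (Fin D) ℝ :=
  ∑ i, Matrix.vecMulVec (u i).ofLp (u i).ofLp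

theorem inner_frobVec_vecMulVec (A : Matrix (Fin D) (Fin D) ℝ) (u : EuclideanSpace ℝ (Fin D)) :
    inner ℝ (frobVec A) (frobVec (Matrix.vecMulVec u.ofLp u.ofLp)) =
      inner ℝ u (WithLp.toLp 2 (A.mulVec u.ofLp)) := by
  rw [inner_frobVec]
  simp only [PiLp.inner_apply, Matrix.mulVec, dotProduct, Matrix.vecMulVec_apply]
  refine Finset.sum_congr rfl fun a _ => ?_
  simp only [RCLike.inner_apply, conj_trivial, Finset.sum_mul]
  exact Finset.sum_congr rfl fun b _ => by ring

theorem inner_vecMulVec_vecMulVec (u v : EuclideanSpace ℝ (Fin D)) :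
    inner ℝ (frobVec (Matrix.vecMulVec u.ofLp u.ofLp)) (frobVec (Matrix.vecMulVec v.ofLp v.ofLp)) =
      inner ℝ u v ^ 2 := by
  rw [inner_frobVec]
  simp only [PiLp.inner_apply, Matrix.vecMulVec_apply, sq, Finset.sum_mul_sum]
  refine Finset.sum_congr rfl fun a _ => Finset.sum_congr rfl fun b _ => ?_
  simp only [RCLike.inner_apply, conj_trivial]
  ring

theorem inner_projectorOf_projectorOf {m l : ℕ} (u : Fin m → EuclideanSpace ℝ (Fin D))
    (w : Fin l → EuclideanSpace ℝ (Fin D)) :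
    inner ℝ (frobVec (projectorOf u)) (frobVec (projectorOf w)) =
      ∑ i, ∑ j, inner ℝ (u i) (w j) ^ 2 := by
  simp only [projectorOf, map_sum, sum_inner, inner_sum, inner_vecMulVec_vecMulVec]
  exact Finset.sum_comm

theorem norm_projectorOf_sq {m : ℕ} {u : Fin m → EuclideanSpace ℝ (Fin D)}
    (hu : Orthonormal ℝ u) : ‖frobVec (projectorOf u)‖ ^ 2 = m := by
  rw [← real_inner_self_eq_norm_sq, inner_projectorOf_projectorOf]
  simp [orthonormal_iff_ite.mp hu]

theorem inner_frobVec_projectorOf {m : ℕ} {A : Matrix (Fin D) (Fin D) ℝ}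
    {u : Fin m → EuclideanSpace ℝ (Fin D)} (hu : Orthonormal ℝ u) {c : Fin m → ℝ}
    (h : ∀ i, A.mulVec (u i).ofLp = c i • (u i).ofLp) :
    inner ℝ (frobVec A) (frobVec (projectorOf u)) = ∑ i, c i := by
  simp only [projectorOf, map_sum, inner_sum, inner_frobVec_vecMulVec, h]
  refine Finset.sum_congr rfl fun i _ => ?_
  rw [WithLp.toLp_smul, inner_smul_right, WithLp.toLp_ofLp, real_inner_self_eq_norm_sq, hu.1 i]
  simp

/-- A symmetric matrix has an orthonormal basis of eigenvectors in the order of its eigenvalues. -/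
theorem exists_eigenbasis {A : Matrix (Fin D) (Fin D) ℝ} (hA : A.IsHermitian) :
    ∃ v : OrthonormalBasis (Fin D) ℝ (EuclideanSpace ℝ (Fin D)),
      ∀ i : Fin D, A.mulVec (v i).ofLp = eigenval A (i + 1) • (v i).ofLp := by
  refine ⟨((Matrix.isSymmetric_toEuclideanLin_iff.mpr hA).eigenvectorBasis
    finrank_euclideanSpace).reindex (finCongr (Fintype.card_fin D)), fun i => ?_⟩
  have h := (Matrix.isSymmetric_toEuclideanLin_iff.mpr hA).apply_eigenvectorBasis
    finrank_euclideanSpace (finCongr (Fintype.card_fin D).symm i)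
  rw [eigenval, dif_pos ⟨hA, by omega, by omega⟩]
  rw [OrthonormalBasis.reindex_apply]
  exact congrArg WithLp.ofLp h

theorem eigenval_antitone {A : Matrix (Fin D) (Fin D) ℝ} (hA : A.IsHermitian) {i j : ℕ}
    (hi : 1 ≤ i) (hij : i ≤ j) (hj : j ≤ D) : eigenval A j ≤ eigenval A i := by
  rw [eigenval, eigenval, dif_pos ⟨hA, hi.trans hij, hj⟩, dif_pos ⟨hA, hi, hij.trans hj⟩]
  refine hA.eigenvalues₀_antitone ?_
  simp only [Fin.mk_le_mk]
  omega

/-- Parseval in the eigenbasis applied to each quadratic form ⟨w j, A w j⟩. The pairing becomes a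
weighted sum of eigenvalues, which reduces Ky Fan's inequality to a comparison of weights. -/
theorem inner_frobVec_projectorOf_eq_sum {ι : Type*} [Fintype ι] {m : ℕ}
    {A : Matrix (Fin D) (Fin D) ℝ} (hA : A.IsHermitian)
    (v : OrthonormalBasis ι ℝ (EuclideanSpace ℝ (Fin D))) {c : ι → ℝ}
    (h : ∀ i, A.mulVec (v i).ofLp = c i • (v i).ofLp) (w : Fin m → EuclideanSpace ℝ (Fin D)) :
    inner ℝ (frobVec A) (frobVec (projectorOf w)) = ∑ i, c i * ∑ j, inner ℝ (v i) (w j) ^ 2 := by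
  simp only [projectorOf, map_sum, inner_sum, inner_frobVec_vecMulVec, Finset.mul_sum]
  rw [Finset.sum_comm]
  refine Finset.sum_congr rfl fun j _ => ?_
  rw [← v.sum_inner_mul_inner]
  refine Finset.sum_congr rfl fun i _ => ?_
  have hsym := Matrix.isSymmetric_toEuclideanLin_iff.mpr hA (v i) (w j)
  have e : inner ℝ (v i) (WithLp.toLp 2 (A.mulVec (w j).ofLp)) = c i * inner ℝ (v i) (w j) := by
    rw [Matrix.toLpLin_apply, Matrix.toLpLin_apply, h, WithLp.toLp_smul, WithLp.toLp_ofLp,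
      inner_smul_left] at hsym
    simpa using hsym.symm
  rw [e, real_inner_comm]
  ring

/-- **Quantitative Ky Fan inequality** for the eigenbasis projector. -/
theorem gap_mul_le_eigenbasis {r m : ℕ} {A : Matrix (Fin (m + r)) (Fin (m + r)) ℝ}
    (hA : A.IsHermitian) (hm : 1 ≤ m)
    (v : OrthonormalBasis (Fin (m + r)) ℝ (EuclideanSpace ℝ (Fin (m + r))))
    (hv : ∀ i : Fin (m + r), A.mulVec (v i).ofLp = eigenval A (i + 1) • (v i).ofLp)
    {w : Fin m → EuclideanSpace ℝ (Fin (m + r))} (hw : Orthonormal ℝ w)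
    {g : ℝ} (hg : 0 < r → g ≤ eigenval A m - eigenval A (m + 1)) :
    g / 2 *
        ‖frobVec (projectorOf fun i : Fin m => v (Fin.castAdd r i)) - frobVec (projectorOf w)‖ ^ 2
      ≤ ∑ i : Fin m, eigenval A (i + 1) - inner ℝ (frobVec A) (frobVec (projectorOf w)) := by
  set c : Fin (m + r) → ℝ := fun i => ∑ j, inner ℝ (v i) (w j) ^ 2 with hc
  have hvo : Orthonormal ℝ fun i : Fin m => v (Fin.castAdd r i) :=
    v.orthonormal.comp _ (Fin.castAdd_injective m r)
  have hc0 : ∀ i, 0 ≤ c i := fun i => Finset.sum_nonneg fun j _ => sq_nonneg _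
  have hc1 : ∀ i, c i ≤ 1 := by
    intro i
    have := hw.sum_inner_products_le (v i) (s := Finset.univ)
    simp only [v.orthonormal.1 i, Real.norm_eq_abs, sq_abs, one_pow] at this
    simpa only [hc, real_inner_comm] using this
  have hcs : ∑ i, c i = m := by
    rw [hc, Finset.sum_comm]
    have : ∀ j, ∑ i, inner ℝ (v i) (w j) ^ 2 = (1 : ℝ) := by
      intro j
      have := v.sum_sq_norm_inner_right (w j)
      simpa [hw.1 j] using this
    simp [this]
  rw [inner_frobVec_projectorOf_eq_sum hA v hv w, norm_sub_sq_real, norm_projectorOf_sq hvo,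
    norm_projectorOf_sq hw, inner_projectorOf_projectorOf]
  change _ / 2 * ((m : ℝ) - 2 * ∑ i, c (Fin.castAdd r i) + m)
    ≤ _ - ∑ i : Fin (m + r), eigenval A (i + 1) * c i
  rw [Fin.sum_univ_add] at hcs ⊢
  -- The weights lie in [0, 1] and sum to m, so the mass m - C missing from the top m indices sits
  -- on the others. Shifting it costs at least the gap per unit, and the squared distance of the
  -- projectors is 2(m - C).
  set C := ∑ i, c (Fin.castAdd r i) with hC
  have h1 : eigenval A m * (m - C) ≤
      ∑ i : Fin m, eigenval A (i + 1) - ∑ i : Fin m, eigenval A (i + 1) * c (Fin.castAdd r i) := by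
    have : (m : ℝ) - C = ∑ i : Fin m, (1 - c (Fin.castAdd r i)) := by simp [hC]
    rw [this, Finset.mul_sum, ← Finset.sum_sub_distrib]
    refine Finset.sum_le_sum fun i _ => ?_
    have h := eigenval_antitone hA (i := i + 1) (j := m) (by omega) (by omega) (by omega)
    nlinarith [hc1 (Fin.castAdd r i)]
  have h2 : ∑ i : Fin r, eigenval A (Fin.natAdd m i + 1) * c (Fin.natAdd m i) ≤
      eigenval A (m + 1) * (m - C) := by
    have : (m : ℝ) - C = ∑ i : Fin r, c (Fin.natAdd m i) := by linarith
    rw [this, Finset.mul_sum]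
    refine Finset.sum_le_sum fun i _ => ?_
    refine mul_le_mul_of_nonneg_right ?_ (hc0 _)
    exact eigenval_antitone hA (by omega) (by simp) (by omega)
  have h3 : g * (m - C) ≤ (eigenval A m - eigenval A (m + 1)) * (m - C) := by
    have hmC : (m : ℝ) - C = ∑ i : Fin r, c (Fin.natAdd m i) := by linarith
    -- For r = 0 the value `eigenval A (m + 1)` is the default 0 and the gap may be negative, but
    -- then m - C = 0.
    rcases Nat.eq_zero_or_pos r with rfl | hr
    · simp [hmC]
    · refine mul_le_mul_of_nonneg_right (hg hr) ?_
      rw [hmC]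
      exact Finset.sum_nonneg fun i _ => hc0 _
  simp only [Fin.val_castAdd]
  linarith

/-- **Quantitative Ky Fan inequality.** -/
theorem IsTopProjector.gap_mul_le {A P : Matrix (Fin D) (Fin D) ℝ} {m : ℕ} (hA : A.IsHermitian)
    (hm : 1 ≤ m) (hmD : m ≤ D) (hP : IsTopProjector A m P)
    (hgap : 0 < eigenval A m - eigenval A (m + 1))
    {w : Fin m → EuclideanSpace ℝ (Fin D)} (hw : Orthonormal ℝ w) :
    (eigenval A m - eigenval A (m + 1)) / 2 * ‖frobVec P - frobVec (projectorOf w)‖ ^ 2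
      ≤ inner ℝ (frobVec A) (frobVec P) - inner ℝ (frobVec A) (frobVec (projectorOf w)) := by
  obtain ⟨r, rfl⟩ := Nat.exists_eq_add_of_le hmD
  obtain ⟨u, hu, hAu, rfl⟩ := hP
  obtain ⟨v, hv⟩ := exists_eigenbasis hA
  have hAP := inner_frobVec_projectorOf hu hAu
  -- With `w = u` the right side vanishes, so a positive gap forces the projector built from `u` to
  -- equal the one from the eigenbasis.
  have h1 := gap_mul_le_eigenbasis hA hm v hv hu fun _ => le_rfl
  have h2 := gap_mul_le_eigenbasis hA hm v hv hw fun _ => le_rfl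
  rw [hAP, sub_self] at h1
  have h3 : ‖frobVec (projectorOf fun i : Fin m => v (Fin.castAdd r i)) -
      frobVec (projectorOf u)‖ ^ 2 = 0 := by
    refine le_antisymm ?_ (sq_nonneg _)
    by_contra! h
    linarith [mul_pos (half_pos hgap) h]
  rw [sq_eq_zero_iff, norm_eq_zero, sub_eq_zero] at h3
  rw [h3] at h2
  change _ ≤ inner ℝ (frobVec A) (frobVec (projectorOf u)) - _
  rw [hAP]
  exact h2

/-- **Ky Fan inequality.** -/
theorem IsTopProjector.inner_le {A P : Matrix (Fin D) (Fin D) ℝ} {m : ℕ} (hA : A.IsHermitian)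
    (hm : 1 ≤ m) (hmD : m ≤ D) (hP : IsTopProjector A m P)
    {w : Fin m → EuclideanSpace ℝ (Fin D)} (hw : Orthonormal ℝ w) :
    inner ℝ (frobVec A) (frobVec (projectorOf w)) ≤ inner ℝ (frobVec A) (frobVec P) := by
  obtain ⟨r, rfl⟩ := Nat.exists_eq_add_of_le hmD
  obtain ⟨u, hu, hAu, rfl⟩ := hP
  obtain ⟨v, hv⟩ := exists_eigenbasis hA
  have h := gap_mul_le_eigenbasis hA hm v hv hw (g := 0) fun hr =>
    sub_nonneg.mpr (eigenval_antitone hA hm (by omega) (by omega))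
  change _ ≤ inner ℝ (frobVec A) (frobVec (projectorOf u))
  rw [inner_frobVec_projectorOf hu hAu]
  linarith

/-- **Davis–Kahan theorem**, Frobenius norm version with the gap of only one of the matrices. -/
theorem davis_kahan {A B P Q : Matrix (Fin D) (Fin D) ℝ} {m : ℕ} (hA : A.IsHermitian)
    (hB : B.IsHermitian) (hm : 1 ≤ m) (hmD : m ≤ D) (hP : IsTopProjector A m P)
    (hQ : IsTopProjector B m Q) (hgap : 0 < eigenval A m - eigenval A (m + 1)) :
    (eigenval A m - eigenval A (m + 1)) * frobNorm (Q - P) ≤ 2 * frobNorm (B - A) := by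
  obtain ⟨u, hu, -, hPu⟩ := id hP
  obtain ⟨w, hw, -, hQw⟩ := id hQ
  -- Since ⟨B, P - Q⟩ ≤ 0, the bound (gap/2)‖Q - P‖² ≤ ⟨A, P - Q⟩ gives (gap/2)‖Q - P‖² ≤ ⟨B - A, Q
  -- - P⟩; Cauchy–Schwarz finishes.
  have h1 := hP.gap_mul_le hA hm hmD hgap hw
  have h2 := hQ.inner_le hB hm hmD hu
  rw [show projectorOf w = Q from hQw.symm] at h1
  rw [show projectorOf u = P from hPu.symm] at h2
  have h3 := real_inner_le_norm (frobVec (B - A)) (frobVec (Q - P))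
  rw [frobNorm_eq_norm, frobNorm_eq_norm]
  rw [← norm_neg, neg_sub, ← map_sub] at h1
  rw [map_sub, map_sub, inner_sub_left, inner_sub_right, inner_sub_right, ← map_sub,
    ← map_sub] at h3
  rcases (norm_nonneg (frobVec (Q - P))).eq_or_lt with h0 | h0
  · rw [← h0, mul_zero]
    positivity
  · refine le_of_mul_le_mul_right ?_ h0
    linarith

end SpectralProjector

/-! ### Independence of blocks and the Chernoff bound. -/

section Chernoff

variable {Ω : Type*} [MeasurableSpace Ω] {P : Measure Ω}

/-- Disjoint blocks of independent random variables are independent. -/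
theorem iIndepFun_blocks {ι κ β : Type*} [MeasurableSpace β] {X : ι → Ω → β}
    (hX : iIndepFun X P) (hm : ∀ i, AEMeasurable (X i) P) (G : κ → Finset ι)
    (hG : ∀ i j, i ≠ j → Disjoint (G i) (G j)) :
    iIndepFun (fun j ω (i : G j) => X i ω) P := by
  classical
  have := hX.isProbabilityMeasure
  rw [iIndepFun_iff_measure_inter_preimage_eq_mul]
  intro S
  induction S using Finset.induction_on with
  | empty => intro sets _; simp
  | insert j S hj ih =>
    intro sets hsets
    have hS : ∀ i ∈ S, MeasurableSet (sets i) := fun i hi => hsets i (Finset.mem_insert_of_mem hi)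
    rw [Finset.prod_insert hj, ← ih hS, Finset.set_biInter_insert]
    have hdisj : Disjoint (G j) (S.biUnion G) := by
      rw [Finset.disjoint_biUnion_right]
      exact fun i hi => hG j i fun h => hj (h ▸ hi)
    -- The new block is independent of the union of the others, from which `r` reads off each single
    -- block.
    have hind := hX.indepFun_finset₀ (G j) (S.biUnion G) hdisj hm
    let r : ∀ i : S, (S.biUnion G → β) → (G i → β) := fun i f l =>
      f ⟨l, Finset.mem_biUnion.mpr ⟨i, i.2, l.2⟩⟩
    have hr : ∀ i, Measurable (r i) := fun i => measurable_pi_lambda _ fun l => measurable_pi_apply _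
    have hB : MeasurableSet (⋂ i : S, r i ⁻¹' sets i) :=
      MeasurableSet.iInter fun i => hr i (hS i i.2)
    have h := hind.measure_inter_preimage_eq_mul _ _ (hsets j (Finset.mem_insert_self _ _)) hB
    convert! h using 2
    · congr 1
      ext ω
      simp [r]
    · congr 1
      ext ω
      simp [r]

/-- The logarithm is the optimal Chernoff parameter t; for it 1 + p(eᵗ - 1) = (1 - p)/(1 - α). -/
theorem exp_mul_pow_eq_exp_psi {α p : ℝ} (hp : 0 < p) (hpα : p < α) (hα : α < 1) (k : ℕ) :
    Real.exp (-Real.log (α * (1 - p) / (p * (1 - α))) * (α * k)) *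
      (1 + p * (Real.exp (Real.log (α * (1 - p) / (p * (1 - α)))) - 1)) ^ k =
    Real.exp (-(k * psi α p)) := by
  have h0 : 0 < α := hp.trans hpα
  have h1 : 0 < 1 - α := by linarith
  have h2 : 0 < 1 - p := by linarith
  rw [Real.exp_log (by positivity)]
  have e : 1 + p * (α * (1 - p) / (p * (1 - α)) - 1) = Real.exp (Real.log ((1 - p) / (1 - α))) := by
    rw [Real.exp_log (by positivity)]
    field_simp
    ring
  rw [e, ← Real.exp_nat_mul, ← Real.exp_add, psi, Real.log_div, Real.log_div, Real.log_div,
    Real.log_div, Real.log_mul, Real.log_mul] <;> try positivity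
  congr 1
  ring

theorem mgf_indicator_comp {β : Type*} [MeasurableSpace β] [IsProbabilityMeasure P] {T : Ω → β}
    (hT : AEMeasurable T P) {s : Set β} (hs : MeasurableSet s) (t : ℝ) :
    mgf (s.indicator 1 ∘ T) P t = 1 + P.real (T ⁻¹' s) * (Real.exp t - 1) := by
  have hm : NullMeasurableSet (T ⁻¹' s) P := hT.nullMeasurableSet_preimage hs
  have e : ∀ ω, Real.exp (t * (s.indicator 1 ∘ T) ω) =
      1 + (T ⁻¹' s).indicator (fun _ => Real.exp t - 1) ω := by
    intro ω
    by_cases h : T ω ∈ s <;> simp [h]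
  have hint : Integrable ((T ⁻¹' s).indicator fun _ => Real.exp t - 1) P :=
    (integrable_const _).indicator₀ hm
  simp only [mgf, e]
  rw [integral_add (integrable_const _) hint, integral_indicator₀ hm]
  simp

/-- **Chernoff bound** for the number of independent events that occur. -/
theorem measureReal_le_card_le_exp_psi [IsProbabilityMeasure P] {k : ℕ} {β : Fin k → Type*}
    [∀ j, MeasurableSpace (β j)] {T : ∀ j, Ω → β j} (hT : iIndepFun T P)
    (hm : ∀ j, AEMeasurable (T j) P) {s : ∀ j, Set (β j)} (hs : ∀ j, MeasurableSet (s j))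
    {α p : ℝ} (hp : 0 < p) (hpα : p < α) (hα : α < 1) (hle : ∀ j, P.real (T j ⁻¹' s j) ≤ p)
    [∀ ω, DecidablePred fun j => T j ω ∈ s j] :
    P.real {ω | α * k ≤ ((Finset.univ.filter fun j => T j ω ∈ s j).card : ℝ)}
      ≤ Real.exp (-(k * psi α p)) := by
  set t := Real.log (α * (1 - p) / (p * (1 - α))) with ht
  have ht0 : 0 ≤ t := by
    refine Real.log_nonneg ?_
    rw [one_le_div (mul_pos hp (by linarith))]
    nlinarith
  let Y : Fin k → Ω → ℝ := fun j => (s j).indicator 1 ∘ T j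
  have hmeas : ∀ j, Measurable ((s j).indicator (1 : β j → ℝ)) := fun j =>
    measurable_one.indicator (hs j)
  have hYm : ∀ j, AEMeasurable (Y j) P := fun j => (hmeas j).comp_aemeasurable (hm j)
  have hY : iIndepFun Y P := hT.comp _ hmeas
  have hsum : ∀ ω, (∑ j, Y j) ω = ((Finset.univ.filter fun j => T j ω ∈ s j).card : ℝ) := by
    intro ω
    simp [Y, Set.indicator_apply]
  have hmgf : mgf (∑ j, Y j) P t ≤ (1 + p * (Real.exp t - 1)) ^ k := by
    rw [hY.mgf_sum₀ hYm, ← Fin.prod_const]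
    refine Finset.prod_le_prod (fun j _ => mgf_nonneg) fun j _ => ?_
    rw [mgf_indicator_comp (hm j) (hs j)]
    have : 0 ≤ Real.exp t - 1 := by linarith [Real.add_one_le_exp t]
    linarith [mul_le_mul_of_nonneg_right (hle j) this]
  have hint : Integrable (fun ω => Real.exp (t * (∑ j, Y j) ω)) P := by
    refine Integrable.of_bound (C := Real.exp (t * k)) ?_ ?_
    · exact ((Finset.aemeasurable_sum _ fun j _ => hYm j).const_mul t).exp.aestronglyMeasurable
    · refine ae_of_all _ fun ω => ?_
      rw [Real.norm_of_nonneg (Real.exp_pos _).le, hsum]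
      refine Real.exp_le_exp.mpr (mul_le_mul_of_nonneg_left ?_ ht0)
      exact_mod_cast (Finset.card_le_univ _).trans_eq (Fintype.card_fin k)
  have h := measure_ge_le_exp_mul_mgf (α * k) ht0 hint
  simp only [hsum] at h
  refine h.trans ((mul_le_mul_of_nonneg_left hmgf (Real.exp_pos _).le).trans_eq ?_)
  exact exp_mul_pow_eq_exp_psi hp hpα hα k

end Chernoff

/-! ### Second moments of sample covariance matrices. -/

section Chebyshev

variable {Ω : Type*} [MeasurableSpace Ω] {P : Measure Ω} {D : ℕ}

theorem memLp_four_of_integrable {X : Ω → EuclideanSpace ℝ (Fin D)} (hX : AEMeasurable X P)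
    (h : Integrable (fun ω => ‖X ω‖ ^ 4) P) : MemLp X 4 P := by
  rw [← integrable_norm_rpow_iff hX.aestronglyMeasurable (by norm_num) (by norm_num)]
  simpa only [ENNReal.toReal_ofNat, Real.rpow_ofNat] using h

theorem memLp_coord {X : Ω → EuclideanSpace ℝ (Fin D)} {p : ENNReal} (h : MemLp X p P)
    (a : Fin D) : MemLp (fun ω => X ω a) p P := by
  refine h.mono ?_ (ae_of_all _ fun ω => PiLp.norm_apply_le (X ω) a)
  exact (EuclideanSpace.proj a : EuclideanSpace ℝ (Fin D) →L[ℝ] ℝ).continuous.comp_aestronglyMeasurable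
    h.1

theorem memLp_coord_mul_coord {X : Ω → EuclideanSpace ℝ (Fin D)} (h : MemLp X 4 P)
    (a b : Fin D) : MemLp (fun ω => X ω a * X ω b) 2 P := by
  have : ENNReal.HolderTriple 4 4 2 := ⟨by
    rw [← ENNReal.toReal_eq_toReal_iff' (by simp) (by simp)]
    norm_num [ENNReal.toReal_add]⟩
  exact (memLp_coord h b).mul' (memLp_coord h a)

theorem covMatrix_apply_of_centered [IsProbabilityMeasure P] {X : Ω → EuclideanSpace ℝ (Fin D)} (h : MemLp X 4 P)
    (h0 : ∫ ω, X ω ∂P = 0) (a b : Fin D) : covMatrix P X a b = ∫ ω, X ω a * X ω b ∂P := by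
  have h2 : MemLp X 2 P := h.mono_exponent (by norm_num)
  have hz : ∀ c, ∫ ω, X ω c ∂P = 0 := by
    intro c
    have := (EuclideanSpace.proj c : EuclideanSpace ℝ (Fin D) →L[ℝ] ℝ).integral_comp_comm
      (h2.integrable (by norm_num))
    rw [h0] at this
    simpa using this
  rw [covMatrix, Matrix.of_apply, covariance_eq_sub (memLp_coord h2 a) (memLp_coord h2 b), hz, hz]
  simp

theorem covMatrix_isHermitian (X : Ω → EuclideanSpace ℝ (Fin D)) :
    (covMatrix P X).IsHermitian := by
  ext a b
  simp [covMatrix, covariance_comm]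

/-- `𝔼 ‖X‖⁴ - tr (Σ²)` is the total variance of the entries of `X Xᵀ`. -/
theorem sum_variance_eq [IsProbabilityMeasure P] {X : Ω → EuclideanSpace ℝ (Fin D)} (h : MemLp X 4 P)
    (h0 : ∫ ω, X ω ∂P = 0) :
    ∑ a, ∑ b, Var[fun ω => X ω a * X ω b; P] =
      (∫ ω, ‖X ω‖ ^ 4 ∂P) - Matrix.trace (covMatrix P X ^ 2) := by
  have e1 : ∀ ω, ‖X ω‖ ^ 4 = ∑ a, ∑ b, (X ω a * X ω b) ^ 2 := by
    intro ω
    have : ‖X ω‖ ^ 4 = ‖X ω‖ ^ 2 * ‖X ω‖ ^ 2 := by ring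
    rw [this, EuclideanSpace.real_norm_sq_eq, Finset.sum_mul_sum]
    simp only [mul_pow]
  have e2 : Matrix.trace (covMatrix P X ^ 2) = ∑ a, ∑ b, (∫ ω, X ω a * X ω b ∂P) ^ 2 := by
    simp only [Matrix.trace, Matrix.diag_apply, sq, Matrix.mul_apply,
      covMatrix_apply_of_centered h h0]
    refine Finset.sum_congr rfl fun a _ => Finset.sum_congr rfl fun b _ => ?_
    simp only [mul_comm]
  have hi : ∀ a b, Integrable (fun ω => (X ω a * X ω b) ^ 2) P := fun a b =>
    (memLp_coord_mul_coord h a b).integrable_sq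
  simp only [e1, e2]
  rw [integral_finsetSum _ fun a _ => integrable_finsetSum _ fun b _ => hi a b,
    ← Finset.sum_sub_distrib]
  refine Finset.sum_congr rfl fun a _ => ?_
  rw [integral_finsetSum _ fun b _ => hi a b, ← Finset.sum_sub_distrib]
  refine Finset.sum_congr rfl fun b _ => ?_
  rw [variance_eq_sub (memLp_coord_mul_coord h a b)]
  rfl

theorem sampleCov_apply {n : ℕ} (x : Fin n → EuclideanSpace ℝ (Fin D)) (G : Finset (Fin n))
    (a b : Fin D) : sampleCov x G a b = (G.card : ℝ)⁻¹ * ∑ i ∈ G, x i a * x i b := by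
  simp [sampleCov, Matrix.sum_apply, Matrix.vecMulVec_apply]

theorem sampleCov_transpose {n : ℕ} (x : Fin n → EuclideanSpace ℝ (Fin D)) (G : Finset (Fin n)) :
    (sampleCov x G).transpose = sampleCov x G := by
  ext a b
  simp [sampleCov_apply, mul_comm]

/-- The mean squared Frobenius error of a sample covariance matrix. -/
theorem integral_norm_sampleCov_sub_sq [IsProbabilityMeasure P] {n : ℕ} {X₀ : Ω → EuclideanSpace ℝ (Fin D)}
    {X : Fin n → Ω → EuclideanSpace ℝ (Fin D)}
    (hident : ∀ i, IdentDistrib (X i) X₀ P P) (hindep : iIndepFun X P) (h : MemLp X₀ 4 P)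
    (h0 : ∫ ω, X₀ ω ∂P = 0) {G : Finset (Fin n)} (hG : 0 < G.card) :
    Integrable (fun ω => ‖frobVec (sampleCov (fun i => X i ω) G - covMatrix P X₀)‖ ^ 2) P ∧
    ∫ ω, ‖frobVec (sampleCov (fun i => X i ω) G - covMatrix P X₀)‖ ^ 2 ∂P =
      ((∫ ω, ‖X₀ ω‖ ^ 4 ∂P) - Matrix.trace (covMatrix P X₀ ^ 2)) / G.card := by
  have hG' : (G.card : ℝ) ≠ 0 := by exact_mod_cast hG.ne'
  have hmc : ∀ a b : Fin D, Measurable fun x : EuclideanSpace ℝ (Fin D) => x a * x b := by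
    intro a b
    fun_prop
  have hid : ∀ a b i, IdentDistrib (fun ω => X i ω a * X i ω b) (fun ω => X₀ ω a * X₀ ω b) P P :=
    fun a b i => (hident i).comp (hmc a b)
  have hX : ∀ i, MemLp (X i) 4 P := fun i => (hident i).memLp_iff.mpr h
  have hL : ∀ a b i, MemLp (fun ω => X i ω a * X i ω b) 2 P := fun a b i =>
    memLp_coord_mul_coord (hX i) a b
  let S : Fin D → Fin D → Ω → ℝ := fun a b => ∑ i ∈ G, fun ω => X i ω a * X i ω b
  have hSL : ∀ a b, MemLp (S a b) 2 P := fun a b => memLp_finsetSum' _ fun i _ => hL a b i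
  have hSL' : ∀ a b, MemLp (fun ω => (G.card : ℝ)⁻¹ * S a b ω) 2 P := fun a b =>
    (hSL a b).const_mul _
  have hmean : ∀ a b, ∫ ω, (G.card : ℝ)⁻¹ * S a b ω ∂P = covMatrix P X₀ a b := by
    intro a b
    rw [integral_const_mul, covMatrix_apply_of_centered h h0]
    simp only [S, Finset.sum_apply]
    rw [integral_finsetSum _ fun i _ => (hL a b i).integrable (by norm_num)]
    simp only [fun i => (hid a b i).integral_eq, Finset.sum_const, nsmul_eq_mul]
    field_simp
  have hvar : ∀ a b, Var[fun ω => (G.card : ℝ)⁻¹ * S a b ω; P] =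
      Var[fun ω => X₀ ω a * X₀ ω b; P] / G.card := by
    intro a b
    rw [variance_const_mul, IndepFun.variance_sum (fun i _ => hL a b i)]
    · simp only [fun i => (hid a b i).variance_eq, Finset.sum_const, nsmul_eq_mul]
      field_simp
    · intro i _ j _ hij
      exact (hindep.indepFun hij).comp (hmc a b) (hmc a b)
  have e : ∀ ω, ‖frobVec (sampleCov (fun i => X i ω) G - covMatrix P X₀)‖ ^ 2 =
      ∑ a, ∑ b, ((G.card : ℝ)⁻¹ * S a b ω - ∫ ω', (G.card : ℝ)⁻¹ * S a b ω' ∂P) ^ 2 := by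
    intro ω
    simp only [norm_frobVec_sq, Matrix.sub_apply, sampleCov_apply, hmean]
    simp only [S, Finset.sum_apply]
  have hi : ∀ a b, Integrable
      (fun ω => ((G.card : ℝ)⁻¹ * S a b ω - ∫ ω', (G.card : ℝ)⁻¹ * S a b ω' ∂P) ^ 2) P := fun a b =>
    ((hSL' a b).sub (memLp_const _)).integrable_sq
  simp only [e]
  refine ⟨integrable_finsetSum _ fun a _ => integrable_finsetSum _ fun b _ => hi a b, ?_⟩
  rw [← sum_variance_eq h h0, Finset.sum_div,
    integral_finsetSum _ fun a _ => integrable_finsetSum _ fun b _ => hi a b]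
  refine Finset.sum_congr rfl fun a _ => ?_
  rw [integral_finsetSum _ fun b _ => hi a b, Finset.sum_div]
  refine Finset.sum_congr rfl fun b _ => ?_
  rw [← hvar, variance_eq_integral (hSL' a b).aemeasurable]

/-- **Chebyshev's inequality** for a sample covariance matrix. -/
theorem measureReal_sampleCov_le [IsProbabilityMeasure P] {n : ℕ} {X₀ : Ω → EuclideanSpace ℝ (Fin D)}
    {X : Fin n → Ω → EuclideanSpace ℝ (Fin D)}
    (hident : ∀ i, IdentDistrib (X i) X₀ P P) (hindep : iIndepFun X P) (h : MemLp X₀ 4 P)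
    (h0 : ∫ ω, X₀ ω ∂P = 0) {G : Finset (Fin n)} (hG : 0 < G.card) {V p : ℝ} (hp : 0 < p)
    (hV : V = (∫ ω, ‖X₀ ω‖ ^ 4 ∂P) - Matrix.trace (covMatrix P X₀ ^ 2)) :
    P.real {ω | √(V / (p * G.card)) < frobNorm (sampleCov (fun i => X i ω) G - covMatrix P X₀)}
      ≤ p := by
  obtain ⟨hint, hval⟩ := integral_norm_sampleCov_sub_sq hident hindep h h0 hG
  have hG' : (0 : ℝ) < G.card := by exact_mod_cast hG
  rw [← hV] at hval
  have hV0 : 0 ≤ V := by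
    have : 0 ≤ V / G.card := hval ▸ integral_nonneg fun ω => sq_nonneg _
    simpa using (le_div_iff₀ hG').mp this
  simp only [frobNorm_eq_norm]
  -- For V = 0 Markov's inequality has threshold 0 and says nothing; instead the error vanishes
  -- almost surely, and the event is strict.
  rcases hV0.eq_or_lt with hV0 | hV0
  · rw [← hV0, zero_div] at hval
    have hae := (integral_eq_zero_iff_of_nonneg (fun ω => sq_nonneg _) hint).mp hval
    have : P.real {ω | √(V / (p * G.card)) <
        ‖frobVec (sampleCov (fun i => X i ω) G - covMatrix P X₀)‖} = 0 := by
      rw [measureReal_eq_zero_iff]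
      refine measure_mono_null ?_ (ae_iff.mp hae)
      intro ω hω h'
      have h2 : ‖frobVec (sampleCov (fun i => X i ω) G - covMatrix P X₀)‖ = 0 := by
        simpa using h'
      simp only [Set.mem_ofPred_eq] at hω
      rw [h2] at hω
      exact absurd hω (not_lt.mpr (Real.sqrt_nonneg _))
    rw [this]
    exact hp.le
  · have hm := mul_meas_ge_le_integral_of_nonneg (ae_of_all _ fun ω => sq_nonneg _) hint
      (V / (p * G.card))
    rw [hval] at hm
    have hsub : P.real {ω | √(V / (p * G.card)) <
        ‖frobVec (sampleCov (fun i => X i ω) G - covMatrix P X₀)‖} ≤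
        P.real {ω | V / (p * G.card) ≤
          ‖frobVec (sampleCov (fun i => X i ω) G - covMatrix P X₀)‖ ^ 2} := by
      refine measureReal_mono fun ω hω => ?_
      exact (Real.sqrt_le_left (norm_nonneg _)).mp (le_of_lt hω)
    refine hsub.trans (le_of_mul_le_mul_left (hm.trans_eq ?_) (by positivity : 0 < V / (p * G.card)))
    field_simp

end Chebyshev

/-! ### Numerical bounds on ψ and k. -/

section NumGroups

/-- The factor 18 clears the denominators of the exponents, so bounds on ψ become comparisons of
rational powers. -/
theorem psi_eq : 18 * psi (7 / 18) (1 / 10) = Real.log ((55 / 81) ^ 11 * (35 / 9) ^ 7) := by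
  rw [Real.log_mul (by norm_num) (by norm_num), Real.log_pow, Real.log_pow, psi]
  norm_num
  ring

theorem five_le_psi : 5 / 18 ≤ psi (7 / 18) (1 / 10) := by
  have h : (5 : ℝ) ≤ Real.log ((55 / 81) ^ 11 * (35 / 9) ^ 7) := by
    rw [Real.le_log_iff_exp_le (by norm_num)]
    have e : Real.exp 5 = Real.exp 1 ^ 5 := by rw [← Real.exp_nat_mul]; norm_num
    rw [e]
    refine (pow_le_pow_left₀ (Real.exp_pos 1).le Real.exp_one_lt_d9.le 5).trans ?_
    norm_num
  linarith [psi_eq]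

/-- Source of the constant 1.4: the `+ 1` in k adds one ψ, so kψ ≤ log(1/δ) + ψ ≤ log(1.4/δ). -/
theorem psi_le_log : psi (7 / 18) (1 / 10) ≤ Real.log 1.4 := by
  have h : Real.log ((55 / 81) ^ 11 * (35 / 9) ^ 7) ≤ 18 * Real.log 1.4 := by
    have e : (18 : ℝ) * Real.log 1.4 = Real.log (1.4 ^ 18) := by rw [Real.log_pow]; norm_num
    rw [e]
    exact Real.log_le_log (by norm_num) (by norm_num)
  linarith [psi_eq]

theorem numGroups_pos (δ : ℝ) : 0 < numGroups δ := Nat.succ_pos _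

theorem exp_neg_numGroups_mul_psi_le {δ : ℝ} (hδ : 0 < δ) :
    Real.exp (-(numGroups δ * psi (7 / 18) (1 / 10))) ≤ δ := by
  have h5 : 0 < psi (7 / 18) (1 / 10) := lt_of_lt_of_le (by norm_num) five_le_psi
  have h := (div_lt_iff₀ h5).mp (Nat.lt_floor_add_one (Real.log (1 / δ) / psi (7 / 18) (1 / 10)))
  rw [one_div, Real.log_inv] at h
  rw [← Real.le_log_iff_exp_le hδ, numGroups]
  push_cast
  rw [one_div δ, Real.log_inv]
  linarith

theorem numGroups_le {δ : ℝ} (hδ₀ : 0 < δ) (hδ₁ : δ < 1) :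
    (numGroups δ : ℝ) ≤ 18 / 5 * Real.log (1.4 / δ) := by
  have h5 : 0 < psi (7 / 18) (1 / 10) := lt_of_lt_of_le (by norm_num) five_le_psi
  have hl : 0 ≤ Real.log (1 / δ) := Real.log_nonneg ((one_le_div hδ₀).mpr hδ₁.le)
  have h := (le_div_iff₀ h5).mp (Nat.floor_le (div_nonneg hl h5.le))
  have h1 : (numGroups δ : ℝ) * psi (7 / 18) (1 / 10) ≤ Real.log (1.4 / δ) := by
    have e1 := Real.log_div (x := 1.4) (by norm_num) hδ₀.ne'
    have e2 := Real.log_div one_ne_zero hδ₀.ne'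
    rw [Real.log_one] at e2
    rw [numGroups]
    push_cast
    linarith [psi_le_log]
  have h2 := mul_le_mul_of_nonneg_left five_le_psi (Nat.cast_nonneg (α := ℝ) (numGroups δ))
  linarith

theorem cast_lt_two_mul_mul_div {n k : ℕ} (hk : 0 < k) (hkn : k ≤ n) :
    (n : ℝ) < 2 * k * (n / k : ℕ) := by
  have h1 : 1 ≤ n / k := (Nat.one_le_div_iff hk).mpr hkn
  have h2 := Nat.lt_mul_div_succ n hk
  have h3 : n < 2 * k * (n / k) := h2.trans_le (by nlinarith)
  exact_mod_cast h3

end NumGroups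

/-! ### Deviation of the median of independent groups. -/

section Concentration

variable {Ω : Type*} [MeasurableSpace Ω] {P : Measure Ω} {D n : ℕ}

/-- Squared Frobenius distance of a sample covariance matrix to `A`, as a function of the
observations of its block. -/
def blockError (A : Matrix (Fin D) (Fin D) ℝ) (G : Finset (Fin n))
    (f : G → EuclideanSpace ℝ (Fin D)) : ℝ :=
  ∑ a, ∑ b, ((G.card : ℝ)⁻¹ * ∑ i, f i a * f i b - A a b) ^ 2

theorem measurable_blockError (A : Matrix (Fin D) (Fin D) ℝ) (G : Finset (Fin n)) :
    Measurable (blockError A G) := by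
  unfold blockError
  fun_prop

theorem frobNorm_sampleCov_sub (A : Matrix (Fin D) (Fin D) ℝ) (G : Finset (Fin n))
    (x : Fin n → EuclideanSpace ℝ (Fin D)) :
    frobNorm (sampleCov x G - A) = √(blockError A G fun i => x i) := by
  rw [frobNorm_eq_norm, eq_comm, Real.sqrt_eq_iff_eq_sq ?_ (norm_nonneg _), norm_frobVec_sq]
  · simp only [blockError, Matrix.sub_apply, sampleCov_apply]
    refine Finset.sum_congr rfl fun a _ => Finset.sum_congr rfl fun b _ => ?_
    rw [Finset.sum_coe_sort G fun i => x i a * x i b]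
  · exact Finset.sum_nonneg fun _ _ => Finset.sum_nonneg fun _ _ => sq_nonneg _

/-- Deviation bound for the geometric median of independent sample covariance matrices. -/
theorem measure_geometricMedian_le [IsProbabilityMeasure P] {k : ℕ} (hk : 0 < k)
    {X : Fin n → Ω → EuclideanSpace ℝ (Fin D)} (hX : ∀ i, AEMeasurable (X i) P)
    (hindep : iIndepFun X P) {G : Fin k → Finset (Fin n)}
    (hG : ∀ i j, i ≠ j → Disjoint (G i) (G j)) {S : Ω → Matrix (Fin D) (Fin D) ℝ}
    (hS : ∀ ω, IsGeometricMedian (fun j => sampleCov (fun i => X i ω) (G j)) (S ω))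
    (A : Matrix (Fin D) (Fin D) ℝ) {ε : ℝ}
    (hε : ∀ j, P.real {ω | ε < frobNorm (sampleCov (fun i => X i ω) (G j) - A)} ≤ 1 / 10) :
    P {ω | ε < √72 / 11 * frobNorm (S ω - A)} ≤
      ENNReal.ofReal (Real.exp (-(k * psi (7 / 18) (1 / 10)))) := by
  classical
  have hc := measureReal_le_card_le_exp_psi (iIndepFun_blocks hindep hX G hG)
    (fun j => aemeasurable_pi_lambda _ fun i => hX i)
    (s := fun j => {f | ε < √(blockError A (G j) f)})
    (fun j => measurableSet_lt measurable_const (measurable_blockError A (G j)).sqrt)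
    (α := 7 / 18) (p := 1 / 10) (by norm_num) (by norm_num) (by norm_num) fun j => by
      have h := hε j
      simp only [frobNorm_sampleCov_sub] at h
      exact h
  -- The event is only included in the measurable event that at least 7k/18 groups are bad, so `S`
  -- may be non-measurable.
  refine le_trans (measure_mono fun ω hω => ?_)
    ((ofReal_measureReal (measure_ne_top _ _)).symm.le.trans (ENNReal.ofReal_le_ofReal hc))
  have : Nonempty (Fin k) := Fin.pos_iff_nonempty.mp hk
  have hmed := card_lt_of_geometric_median
    (fun j => frobVec (sampleCov (fun i => X i ω) (G j))) (frobVec (S ω)) (frobVec A)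
    (fun w => by
      obtain ⟨W, rfl⟩ : ∃ W, frobVec W = w := ⟨Matrix.of fun a b => w (a, b), rfl⟩
      simpa only [frobNorm_eq_norm, map_sub] using hS ω W)
    -- The value s = 7/11 solves s/(1 + s) = 7/18, and then c² = 1 - 49/121 = 72/121.
    (r := ε) (c := √72 / 11) (s := 7 / 11) (by positivity)
    (by rw [div_pow, div_pow, Real.sq_sqrt (by norm_num)]; norm_num)
    (by simpa only [frobNorm_eq_norm, map_sub, Set.mem_ofPred_eq] using hω)
  simp only [← map_sub, ← frobNorm_eq_norm, frobNorm_sampleCov_sub, not_le] at hmed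
  have hcard : (((Finset.univ.filter fun j => √(blockError A (G j) fun i => X i ω) ≤ ε).card : ℕ)
      : ℝ) + (Finset.univ.filter fun j => ε < √(blockError A (G j) fun i => X i ω)).card = k := by
    have := Finset.card_filter_add_card_filter_not (s := Finset.univ)
      fun j => √(blockError A (G j) fun i => X i ω) ≤ ε
    simp only [not_le, Finset.card_univ, Fintype.card_fin] at this
    exact_mod_cast this
  simp only [Set.mem_ofPred_eq]
  linarith

end Concentration

end RobustPCA

end

open RobustPCA

theorem corollary4p3
    {Ω : Type*} [MeasurableSpace Ω] (P : Measure Ω) [IsProbabilityMeasure P]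
    (D n : ℕ)
    -- `X₀` is the generic vector `X`; `X 1, …, X n` are independent copies of it
    (X₀ : Ω → EuclideanSpace ℝ (Fin D)) (X : Fin n → Ω → EuclideanSpace ℝ (Fin D))
    (hident : ∀ i, IdentDistrib (X i) X₀ P P) (hindep : iIndepFun X P)
    (hmoment : Integrable (fun ω => ‖X₀ ω‖ ^ 4) P)
    (hcentered : ∫ ω, X₀ ω ∂P = 0)
    (δ : ℝ) (hδ₀ : 0 < δ) (hδ₁ : δ < 1)
    (hk : RobustPCA.numGroups δ ≤ n)
    -- the groups `G 1, …, G k`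
    (G : Fin (RobustPCA.numGroups δ) → Finset (Fin n))
    (hGdisj : ∀ i j, i ≠ j → Disjoint (G i) (G j))
    (hGcard : ∀ j, (G j).card = n / RobustPCA.numGroups δ)
    -- the estimator of the covariance matrix
    (Sigmahat : Ω → Matrix (Fin D) (Fin D) ℝ)
    (hSigmahat : ∀ ω, RobustPCA.IsGeometricMedian
      (fun j => RobustPCA.sampleCov (fun i => X i ω) (G j)) (Sigmahat ω))
    (m : ℕ) (hm₁ : 1 ≤ m) (hmD : m ≤ D)
    -- the projectors for the covariance matrix and for its estimator
    (Proj : Matrix (Fin D) (Fin D) ℝ)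
    (hProj : RobustPCA.IsTopProjector (RobustPCA.covMatrix P X₀) m Proj)
    (Projhat : Ω → Matrix (Fin D) (Fin D) ℝ)
    (hProjhat : ∀ ω, RobustPCA.IsTopProjector (Sigmahat ω) m (Projhat ω))
    (Δ V : ℝ)
    (hΔ : Δ = RobustPCA.eigenval (RobustPCA.covMatrix P X₀) m
      - RobustPCA.eigenval (RobustPCA.covMatrix P X₀) (m + 1))
    (hV : V = (∫ ω, ‖X₀ ω‖ ^ 4 ∂P) - Matrix.trace (RobustPCA.covMatrix P X₀ ^ 2))
    (hgap : 44 * √(V * Real.log (1.4 / δ) / n) < Δ) :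
    P {ω | 22 / Δ * √(V * Real.log (1.4 / δ) / n)
        < RobustPCA.frobNorm (Projhat ω - Proj)} ≤ ENNReal.ofReal δ ∧
    (0 < V →
      P {ω | 22 / Δ * √(V * Real.log (1.4 / δ) / n)
        ≤ RobustPCA.frobNorm (Projhat ω - Proj)} ≤ ENNReal.ofReal δ) := by
  have hk0 := numGroups_pos δ
  have hn0 : 0 < n := hk0.trans_le hk
  have hn : (0 : ℝ) < n := by exact_mod_cast hn0
  have hG0 : 0 < n / numGroups δ := Nat.div_pos hk hk0
  have hN : (0 : ℝ) < (n / numGroups δ : ℕ) := by exact_mod_cast hG0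
  have hX : ∀ i, AEMeasurable (X i) P := fun i => (hident i).aemeasurable_fst
  have hL4 : MemLp X₀ 4 P :=
    memLp_four_of_integrable (hident ⟨0, hn0⟩).aemeasurable_snd hmoment
  have hV0 : 0 ≤ V := by
    rw [hV, ← sum_variance_eq hL4 hcentered]
    exact Finset.sum_nonneg fun a _ => Finset.sum_nonneg fun b _ => variance_nonneg _ _
  set R := √(V * Real.log (1.4 / δ) / n) with hR
  have hΔ0 : 0 < Δ := lt_of_le_of_lt (by positivity) hgap
  set ε := √(V / (1 / 10 * (n / numGroups δ : ℕ))) with hε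
  have hbound : P {ω | ε < √72 / 11 * frobNorm (Sigmahat ω - covMatrix P X₀)} ≤
      ENNReal.ofReal δ := by
    refine (measure_geometricMedian_le hk0 hX hindep hGdisj hSigmahat _ fun j => ?_).trans
      (ENNReal.ofReal_le_ofReal (exp_neg_numGroups_mul_psi_le hδ₀))
    have := measureReal_sampleCov_le hident hindep hL4 hcentered (G := G j) (hGcard j ▸ hG0)
      (p := 1 / 10) (by norm_num) hV
    rwa [hGcard j] at this
  have hDK : ∀ ω, Δ * frobNorm (Projhat ω - Proj) ≤
      2 * frobNorm (Sigmahat ω - covMatrix P X₀) := by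
    intro ω
    rw [hΔ] at hΔ0 ⊢
    exact davis_kahan (covMatrix_isHermitian X₀)
      ((hSigmahat ω).isHermitian hk0 fun j => sampleCov_transpose _ _) hm₁ hmD hProj
      (hProjhat ω) hΔ0
  -- From n < 2kN and k ≤ (18/5) log(1.4/δ), with 72 = 10 · 2 · 18/5.
  have hcoef : 10 / ((n / numGroups δ : ℕ) : ℝ) < 72 * (Real.log (1.4 / δ) / n) := by
    have h1 := cast_lt_two_mul_mul_div hk0 hk
    have h2 := mul_le_mul_of_nonneg_right (numGroups_le hδ₀ hδ₁) hN.le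
    rw [← mul_div_assoc, div_lt_div_iff₀ hN hn]
    linarith
  have h72 : √72 * R = √(V * (72 * (Real.log (1.4 / δ) / n))) := by
    rw [hR, ← Real.sqrt_mul (by norm_num)]
    congr 1
    ring
  have hε' : ε = √(V * (10 / (n / numGroups δ : ℕ))) := by
    rw [hε]
    congr 1
    field_simp
  have hsqrt : (0 : ℝ) < √72 / 11 := by positivity
  have hscale : √72 / 11 * (11 * R) = √72 * R := by ring
  refine ⟨(measure_mono fun ω hω => ?_).trans hbound,
    fun hVpos => (measure_mono fun ω hω => ?_).trans hbound⟩
  · simp only [Set.mem_ofPred_eq] at hω ⊢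
    rw [div_mul_eq_mul_div, div_lt_iff₀ hΔ0] at hω
    have h1 : ε ≤ √72 * R := by
      rw [h72, hε']
      exact Real.sqrt_le_sqrt (mul_le_mul_of_nonneg_left hcoef.le hV0)
    have h2 : 11 * R < frobNorm (Sigmahat ω - covMatrix P X₀) := by linarith [hDK ω]
    linarith [mul_lt_mul_of_pos_left h2 hsqrt]
  · simp only [Set.mem_ofPred_eq] at hω ⊢
    rw [div_mul_eq_mul_div, div_le_iff₀ hΔ0] at hω
    have h1 : ε < √72 * R := by
      rw [h72, hε']
      exact Real.sqrt_lt_sqrt (by positivity) (mul_lt_mul_of_pos_left hcoef hVpos)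
    have h2 : 11 * R ≤ frobNorm (Sigmahat ω - covMatrix P X₀) := by linarith [hDK ω]
    linarith [mul_le_mul_of_nonneg_left h2 hsqrt.le]
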